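/- **Conventions.** A raviolo vertex algebra is a complex vector space $\mathcal V$ graded by parity $|O|\in\mathbf Z/2$ (governing all signs), $R$-charge and spin, with a vacuum $|0\rangle$, a translation operator $\partial$, and fields $O(z)=\sum_{n<0}z^{-n-1}O_{(n)}+\sum_{n\ge 0}\Omega^n_z O_{(n)}$ depending linearly on $O\in\mathcal V$, where $\Omega_z^n$ has degree $1$, compatible with the gradings and satisfying the vacuum and translation axioms. It is local and associative: for all $O_1,O_2,v$, the matrix elements of $O_1(z)O_2(w)v$, of $(-1)^{|O_1||O_2|}O_2(w)O_1(z)v$ and of the operator product $\sum_{m<0}(z-w)^{-m-1}(O_{1,(m)}O_2)(w)v+\sum_{m\ge0}\Omega^m_{z-w}(O_{1,(m)}O_2)(w)v$ are the expansions (for small $w$, small $z$, small $z-w$) of one element of $\mathcal K_{z,w,z-w}$, the graded algebra generated over $\mathbf C[[z,w]]$ by $\Omega^n_z,\Omega^n_w,\Omega^n_{z-w}$ with $x^n\Omega_x^m=\Omega_x^{m-n}$ (zero if $n>m$) and $\Omega^0_{z-w}\Omega^0_z+\Omega^0_w\Omega^0_{z-w}+\Omega^0_z\Omega^0_w=0$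 together with its derivatives; the order of the pole in $z-w$ is bounded independently of $v$ and of the matrix element. We write $O_1(z)O_2(w)\sim\sum_{n\ge0}\Omega^n_{z-w}(O_{1,(n)}O_2)(w)$ and ${:}O_1O_2{:}=O_{1,(-1)}O_2$. It is *$N=2$ superconformal* if it has fermionic vectors $\Gamma,\sigma$ and bosonic vectors $Q^\pm$, all of $R$-charge $1$ and of spins $2,1,\tfrac32$, and a central charge $\xi$ (a fermionic vector of $R$-charge $1$ and spin $0$ with $\partial\xi=0$), such that $\Gamma_{(0)}=\partial$, $\Gamma_{(1)}$ is the spin, $\sigma_{(0)}$ is diagonalizable with real eigenvalues ($S$-charges), and $$\Gamma\Gamma\sim\tfrac{\xi}{2}\Omega^3+2\Omega^1\Gamma+\Omega^0\partial\Gamma,\quad \sigma\sigma\sim\tfrac{\xi}{3}\Omega^1,\quad \Gamma\sigma\sim\Omega^1\sigma+\Omega^0\partial\sigma,\quad \Gamma Q^\pm\sim\tfrac32\Omega^1Q^\pm+\Omega^0\partial Q^\pm,$$ $$\sigma Q^\pm\sim\pm\Omega^0Q^\pm,\quad Q^\pm Q^\pm\sim0,\quad Q^\pm Q^\mp\sim-\tfrac{\xi}{3}\Omega^2\mp\Omega^1\sigma+\Omega^0(-\Gamma\mp\tfrac12\partial\sigma).$$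 It satisfies the *BPS bound* if there are no nonzero vectors of spin $j$ and $S$-charge $q$ with $j<|q|/2$. A *superpotential* is a bosonic vector $W$ of $R$-charge $2$ and spin $1$ with $W_{(0)}W\in\operatorname{im}\partial$, $\Gamma W\sim\Omega^1W+\Omega^0\partial W$, $\sigma W\sim0$ and $W_{(0)}Q^\pm=0$; put $D_WO=W_{(0)}O$. A *Higgs branch primary* of spin $j$ and $S$-charge $q$ is a homogeneous vector $O$ of spin $j$ with $\Gamma O\sim j\Omega^1O+\Omega^0\partial O$, $\sigma O\sim q\Omega^0O$, $Q^+O\sim0$ and $Q^-O\sim\Omega^0\Psi_O$, where the superpartner $\Psi_O$ has the opposite parity, the same $R$-charge, and satisfies the same $\Gamma$- and $\sigma$-OPEs with spin $j+\tfrac12$ and $S$-charge $q-1$. *Coulomb branch primaries* are defined in the same way with $Q^+$ and $Q^-$ exchanged and $q-1$ replaced by $q+1$. For primaries of one branch put $$\{O_1,O_2\}=\tfrac12\Big((\Psi_{O_1})_{(0)}O_2-(-1)^{|O_1||O_2|}(\Psi_{O_2})_{(0)}O_1\Big).$$ **Corollary.** Let $\mathcal V$ be an $N=2$ superconformal raviolo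 vertex algebra satisfying the BPS bound, with superpotential $W$. On each of the two branches: 1. if $O$ is a branch primary of spin $j$ and $S$-charge $q$, then so is $D_WO$, with parity $|O|+1$, with $R$-charge one higher than that of $O$, and with superpartner $-D_W\Psi_O$; 2. for branch primaries $O_1,O_2$, $$D_W\{O_1,O_2\}=\{D_WO_1,O_2\}+(-1)^{|O_1|}\{O_1,D_WO_2\};$$ 3. the linear span of the branch primaries, with unit $|0\rangle$, product ${:}O_1O_2{:}$, the bilinear extension of the bracket $\{\,,\}$ and the differential $D_W$, is a dg $2$-shifted Poisson algebra: it is a graded-commutative associative unital algebra, the bracket is graded skew-symmetric, satisfies the graded Jacobi identity, is a derivation of the product and has degree $-2$, and $D_W$ has degree $1$, squares to zero and is a derivation of the product and of the bracket. The degree is $R+\sigma_{(0)}$ on the Higgs branch and $R-\sigma_{(0)}$ on the Coulomb branch, and signs are governed by parity. -/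

import Mathlib

noncomputable section

namespace Raviolo

/-- The Koszul sign `(-1)^p` of a parity `p`. -/
def sgn (p : ZMod 2) : ℂ := if p = 0 then 1 else -1

/-! Formal raviolo distributions in one variable are indexed by `ℤ`: the index `n < 0` stands for
the degree `0` symbol `z ^ (-n-1)` and the index `n ≥ 0` for the degree `1` symbol `Ω_z ^ n`.
In the constructors of `ℤ`, `Int.negSucc a` stands for `z ^ a` and `Int.ofNat a` for `Ω_z ^ a`. -/

/-- Parity of the symbol with index `n`. -/
def symPar (n : ℤ) : ZMod 2 := if 0 ≤ n then 1 else 0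

/-- Cohomological degree of the symbol with index `n`. -/
def symDeg (n : ℤ) : ℝ := if 0 ≤ n then 1 else 0

/-- Elements of `𝒦_{z,w,z-w}`, the functions on the formal two-point configuration space of the
raviolo. The element represented is
`∑ reg a b z^a w^b + ∑ Ω_z^a polZ_a(w) + ∑ Ω_w^b polW_b(z) + ∑ Ω_{z-w}^l polD_l(w)`
`+ ∑ polZW(a,b) Ω_z^a Ω_w^b + ∑ polDW(l,b) Ω_{z-w}^l Ω_w^b`.
The remaining degree two products `Ω_{z-w}^l Ω_z^b` are combinations of the ones above by the
relation `Ω_{z-w}^0 Ω_z^0 + Ω_w^0 Ω_{z-w}^0 + Ω_z^0 Ω_w^0 = 0` and its derivatives. -/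
structure ConfFun where
  reg : ℕ → ℕ → ℂ
  polZ : ℕ →₀ PowerSeries ℂ
  polW : ℕ →₀ PowerSeries ℂ
  polD : ℕ →₀ PowerSeries ℂ
  polZW : ℕ × ℕ →₀ ℂ
  polDW : ℕ × ℕ →₀ ℂ

namespace ConfFun

/-- No `Ω_{z-w}^l` with `l ≥ N` occurs. -/
def PoleLT (f : ConfFun) (N : ℕ) : Prop :=
  ∀ l, N ≤ l → f.polD l = 0 ∧ ∀ b, f.polDW (l, b) = 0

/-- The expansion in `ℂ⟪z⟫⟪w⟫` (small `w`),
`Ω_{z-w}^l ↦ ∑_n binom(l+n, n) w^n Ω_z^{l+n}`;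
the value at `m, n` is the coefficient of (symbol `m` in `z`) (symbol `n` in `w`). -/
def expandZW (f : ConfFun) : ℤ → ℤ → ℂ
  | .negSucc a, .negSucc b => f.reg a b
  | .ofNat a, .negSucc b => PowerSeries.coeff b (f.polZ a) +
      f.polD.sum fun l h =>
        if l ≤ a ∧ a ≤ l + b then (a.choose l : ℂ) * PowerSeries.coeff (l + b - a) h else 0
  | .negSucc a, .ofNat b => PowerSeries.coeff a (f.polW b)
  | .ofNat a, .ofNat b => f.polZW (a, b) +
      ∑ l ∈ Finset.range (a + 1), (a.choose l : ℂ) * f.polDW (l, b + (a - l))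

/-- The expansion in `ℂ⟪w⟫⟪z⟫` (small `z`),
`Ω_{z-w}^l ↦ (-1)^l ∑_n binom(l+n, n) z^n Ω_w^{l+n}`;
the value at `m, n` is the coefficient of (symbol `m` in `z`) (symbol `n` in `w`), in this
order. -/
def expandWZ (f : ConfFun) : ℤ → ℤ → ℂ
  | .negSucc a, .negSucc b => f.reg a b
  | .ofNat a, .negSucc b => PowerSeries.coeff b (f.polZ a)
  | .negSucc a, .ofNat b => PowerSeries.coeff a (f.polW b) +
      f.polD.sum fun l h =>
        if b ≤ l + a then
          (-1) ^ l * ((l + a).choose a : ℂ) * PowerSeries.coeff (l + a - b) h else 0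
  | .ofNat a, .ofNat b => f.polZW (a, b)

/-- The expansion in `ℂ⟪w⟫⟪z-w⟫` (small `z-w`),
`z ↦ (z-w) + w`, `Ω_z^a ↦ ∑_n (-1)^n binom(a+n, n) (z-w)^n Ω_w^{a+n}`;
the value at `m, n` is the coefficient of (symbol `m` in `z-w`) (symbol `n` in `w`). -/
def expandDW (f : ConfFun) : ℤ → ℤ → ℂ
  | .negSucc i, .negSucc j =>
      ∑ s ∈ Finset.range (j + 1), ((i + s).choose i : ℂ) * f.reg (i + s) (j - s)
  | .negSucc i, .ofNat j =>
      (f.polZ.sum fun a g =>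
        if j ≤ a + i then
          (-1) ^ i * ((a + i).choose i : ℂ) * PowerSeries.coeff (a + i - j) g else 0) +
      f.polW.sum fun b g =>
        if j ≤ b then
          ((b - j + i).choose i : ℂ) * PowerSeries.coeff (b - j + i) g else 0
  | .ofNat l, .negSucc k => PowerSeries.coeff k (f.polD l)
  | .ofNat l, .ofNat b => f.polDW (l, b)

end ConfFun

end Raviolo

open Raviolo

/-- A raviolo vertex algebra over `ℂ` with super and spin gradings. `gr p r j` is the space of
vectors of (totalized) parity `p`, `R`-charge `r` and spin `j`; `mode n a` is `a_(n)`, so that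
`Y(a, z) = ∑_{n<0} z^{-n-1} a_(n) + ∑_{n≥0} Ω_z^n a_(n)`. -/
structure RavioloVertexAlgebra (V : Type*) [AddCommGroup V] [Module ℂ V] where
  gr : ZMod 2 → ℝ → ℝ → Submodule ℂ V
  isInternal : DirectSum.IsInternal fun i : ZMod 2 × ℝ × ℝ => gr i.1 i.2.1 i.2.2
  vac : V
  T : V →ₗ[ℂ] V
  mode : ℤ → V →ₗ[ℂ] V →ₗ[ℂ] V
  vac_mem : vac ∈ gr 0 0 0
  T_mem : ∀ {p r j a}, a ∈ gr p r j → T a ∈ gr p r (j + 1)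
  /-- The state-field correspondence has degree `0`. -/
  mode_mem : ∀ {p r j a p' r' j' b} (n : ℤ), a ∈ gr p r j → b ∈ gr p' r' j' →
    mode n a b ∈ gr (p + p' + symPar n) (r + r' - symDeg n) (j + j' - n - 1)
  /-- `Y(a, z)` is a raviolo field. -/
  field : ∀ a v, ∃ N : ℤ, ∀ n, N ≤ n → mode n a v = 0
  vac_mode : ∀ n v, mode n vac v = if n = -1 then v else 0
  mode_vac : ∀ a (n : ℤ), 0 ≤ n → mode n a vac = 0
  create : ∀ a, mode (-1) a vac = a
  T_vac : T vac = 0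
  translation : ∀ (a : V) (n : ℤ) (v : V),
    T (mode n a v) - mode n a (T v) = -(n : ℂ) • mode (n - 1) a v
  /-- Locality and associativity: all matrix elements of `a(z) b(w)`, of
  `(-1)^{|a||b|} b(w) a(z)` and of `Y(Y(a, z-w) b, w)` are the expansions, in the three
  respective domains, of one element of `𝒦_{z,w,z-w}`, with a uniformly bounded pole at `z = w`.
  The signs come from moving the degree one symbols to the left of the modes and the symbols in
  `z` to the left of those in `w`. -/
  locality : ∀ (p q : ZMod 2) (a b : V),
    a ∈ (⨆ r, ⨆ j, gr p r j) → b ∈ (⨆ r, ⨆ j, gr q r j) →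
    ∃ N : ℕ, ∀ (v : V) (φ : Module.Dual ℂ V), ∃ f : ConfFun, f.PoleLT N ∧ ∀ m n : ℤ,
      sgn ((p + symPar m) * symPar n) * φ (mode m a (mode n b v)) = f.expandZW m n ∧
      sgn (p * q + q * symPar m) * φ (mode n b (mode m a v)) = f.expandWZ m n ∧
      φ (mode n (mode m a b) v) = f.expandDW m n

namespace RavioloVertexAlgebra

variable {V : Type*} [AddCommGroup V] [Module ℂ V] (𝓥 : RavioloVertexAlgebra V)

/-- The singular part of the OPE of `a` and `b`:
`a(z) b(w) ∼ ∑_n Ω_{z-w}^n c_n(w)` for `c = [c_0, c_1, …]`. -/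
def HasOPE (a b : V) (c : List V) : Prop :=
  ∀ n : ℕ, 𝓥.mode n a b = c.getD n 0

/-- The normally-ordered product of states. -/
def nop (a b : V) : V := 𝓥.mode (-1) a b

end RavioloVertexAlgebra

/-- An `N = 2` superconformal raviolo vertex algebra: a conformal one (stress tensor `Γ`, central
charge `ξ`, with `Γ_(0)` the translation operator and `Γ_(1)` the spin) with the superconformal
current `σ` and the supercharges `Q⁺ = Qp`, `Q⁻ = Qm`. The `S`-charge is the eigenvalue of
`σ_(0)`. -/
structure N2SuperconformalRVA (V : Type*) [AddCommGroup V] [Module ℂ V] extends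
    RavioloVertexAlgebra V where
  ξ : V
  Γ : V
  σ : V
  Qp : V
  Qm : V
  ξ_mem : ξ ∈ gr 1 1 0
  Γ_mem : Γ ∈ gr 1 1 2
  σ_mem : σ ∈ gr 1 1 1
  Qp_mem : Qp ∈ gr 0 1 (3 / 2)
  Qm_mem : Qm ∈ gr 0 1 (3 / 2)
  /-- `ξ` is central: its field is constant. -/
  T_ξ : T ξ = 0
  Γ_zero : ∀ v, mode 0 Γ v = T v
  Γ_one : ∀ {p r j v}, v ∈ gr p r j → mode 1 Γ v = (j : ℂ) • v
  /-- The grading by `S`-charge. -/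
  sGrading : (⨆ q : ℝ, Module.End.eigenspace (mode 0 σ) (q : ℂ)) = ⊤
  ope_ΓΓ : toRavioloVertexAlgebra.HasOPE Γ Γ [T Γ, (2 : ℂ) • Γ, 0, (1 / 2 : ℂ) • ξ]
  ope_σσ : toRavioloVertexAlgebra.HasOPE σ σ [0, (1 / 3 : ℂ) • ξ]
  ope_Γσ : toRavioloVertexAlgebra.HasOPE Γ σ [T σ, σ]
  ope_ΓQp : toRavioloVertexAlgebra.HasOPE Γ Qp [T Qp, (3 / 2 : ℂ) • Qp]
  ope_ΓQm : toRavioloVertexAlgebra.HasOPE Γ Qm [T Qm, (3 / 2 : ℂ) • Qm]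
  ope_σQp : toRavioloVertexAlgebra.HasOPE σ Qp [Qp]
  ope_σQm : toRavioloVertexAlgebra.HasOPE σ Qm [-Qm]
  ope_QpQp : toRavioloVertexAlgebra.HasOPE Qp Qp []
  ope_QmQm : toRavioloVertexAlgebra.HasOPE Qm Qm []
  ope_QpQm : toRavioloVertexAlgebra.HasOPE Qp Qm
    [-Γ - (1 / 2 : ℂ) • T σ, -σ, -(1 / 3 : ℂ) • ξ]
  ope_QmQp : toRavioloVertexAlgebra.HasOPE Qm Qp
    [-Γ + (1 / 2 : ℂ) • T σ, σ, -(1 / 3 : ℂ) • ξ]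

namespace Raviolo

/-- The two branches. -/
inductive Branch
  | higgs
  | coulomb

/-- `+1` for the Higgs branch and `-1` for the Coulomb branch. -/
def Branch.sign : Branch → ℝ
  | .higgs => 1
  | .coulomb => -1

/-- A dg `2`-shifted Poisson algebra structure on `A`: a unital graded-commutative algebra with a
Poisson bracket of degree `-2` and a differential of degree `1` which is a derivation of both.
`gr p s` is the space of elements of parity `p` and degree `s`; signs are governed by the
parity. -/
structure DG2ShiftedPoisson (A : Type*) [AddCommGroup A] [Module ℂ A] where
  gr : ZMod 2 → ℝ → Submodule ℂ A
  isInternal : DirectSum.IsInternal fun i : ZMod 2 × ℝ => gr i.1 i.2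
  one : A
  mul : A →ₗ[ℂ] A →ₗ[ℂ] A
  bracket : A →ₗ[ℂ] A →ₗ[ℂ] A
  d : A →ₗ[ℂ] A
  one_mem : one ∈ gr 0 0
  mul_mem : ∀ {p s a p' s' b}, a ∈ gr p s → b ∈ gr p' s' → mul a b ∈ gr (p + p') (s + s')
  bracket_mem : ∀ {p s a p' s' b}, a ∈ gr p s → b ∈ gr p' s' →
    bracket a b ∈ gr (p + p') (s + s' - 2)
  d_mem : ∀ {p s a}, a ∈ gr p s → d a ∈ gr (p + 1) (s + 1)
  one_mul : ∀ a, mul one a = a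
  mul_assoc : ∀ a b c, mul (mul a b) c = mul a (mul b c)
  mul_comm : ∀ {p s a p' s' b}, a ∈ gr p s → b ∈ gr p' s' → mul a b = sgn (p * p') • mul b a
  bracket_skew : ∀ {p s a p' s' b}, a ∈ gr p s → b ∈ gr p' s' →
    bracket a b = -(sgn (p * p') • bracket b a)
  leibniz : ∀ {p s a p' s' b}, a ∈ gr p s → b ∈ gr p' s' → ∀ c,
    bracket a (mul b c) = mul (bracket a b) c + sgn (p * p') • mul b (bracket a c)
  jacobi : ∀ {p s a p' s' b}, a ∈ gr p s → b ∈ gr p' s' → ∀ c,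
    bracket a (bracket b c) = bracket (bracket a b) c + sgn (p * p') • bracket b (bracket a c)
  d_d : ∀ a, d (d a) = 0
  d_mul : ∀ {p s a}, a ∈ gr p s → ∀ b, d (mul a b) = mul (d a) b + sgn p • mul a (d b)
  d_bracket : ∀ {p s a}, a ∈ gr p s → ∀ b,
    d (bracket a b) = bracket (d a) b + sgn p • bracket a (d b)

end Raviolo

namespace N2SuperconformalRVA

variable {V : Type*} [AddCommGroup V] [Module ℂ V] (𝓥 : N2SuperconformalRVA V)

/-- The BPS bound: `V^{r,(j),q} = 0` for `j < |q| / 2`. -/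
def SatisfiesBPS : Prop :=
  ∀ (p : ZMod 2) (r j q : ℝ), j < |q| / 2 →
    𝓥.gr p r j ⊓ Module.End.eigenspace (𝓥.mode 0 𝓥.σ) (q : ℂ) = ⊥

/-- The supercharge whose OPE with the primaries of the branch is regular. -/
def Qreg : Branch → V
  | .higgs => 𝓥.Qp
  | .coulomb => 𝓥.Qm

/-- The supercharge which produces the superpartners on the branch. -/
def Qdesc : Branch → V
  | .higgs => 𝓥.Qm
  | .coulomb => 𝓥.Qp

/-- The superpartner `Ψ_O`: the coefficient of `Ω_{z-w}^0` in the OPE of `Q^∓` with `O`. -/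
def superpartner (β : Branch) : V →ₗ[ℂ] V := 𝓥.mode 0 (𝓥.Qdesc β)

/-- `O` is a raviolo Virasoro primary of spin `j` and a primary of `S`-charge `q` for the
superconformal current. -/
def IsSCPrimary (j q : ℝ) (O : V) : Prop :=
  𝓥.HasOPE 𝓥.Γ O [𝓥.T O, (j : ℂ) • O] ∧ 𝓥.HasOPE 𝓥.σ O [(q : ℂ) • O]

/-- `O` is a Higgs (resp. Coulomb) branch primary operator of parity `p`, `R`-charge `r`,
spin `j` and `S`-charge `q`. -/
structure IsBranchPrimary (β : Branch) (p : ZMod 2) (r j q : ℝ) (O : V) : Prop where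
  mem : O ∈ 𝓥.gr p r j
  primary : 𝓥.IsSCPrimary j q O
  ope_Qreg : 𝓥.HasOPE (𝓥.Qreg β) O []
  ope_Qdesc : 𝓥.HasOPE (𝓥.Qdesc β) O [𝓥.superpartner β O]
  partner_mem : 𝓥.superpartner β O ∈ 𝓥.gr (p + 1) r (j + 1 / 2)
  partner_primary : 𝓥.IsSCPrimary (j + 1 / 2) (q - β.sign) (𝓥.superpartner β O)

/-- The space underlying the Higgs (resp. Coulomb) branch chiral ring: the linear span of the
(homogeneous) branch primary operators. -/
def chiralRing (β : Branch) : Submodule ℂ V :=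
  Submodule.span ℂ {O | ∃ p r j q, 𝓥.IsBranchPrimary β p r j q O}

/-- The part of the chiral ring of parity `p` and branch `R`-charge `s`; the branch `R`-charge is
`R + σ_(0)` on the Higgs branch and `R - σ_(0)` on the Coulomb branch. -/
def chiralRingPart (β : Branch) (p : ZMod 2) (s : ℝ) : Submodule ℂ V :=
  Submodule.span ℂ {O | ∃ r j q, 𝓥.IsBranchPrimary β p r j q O ∧ r + β.sign * q = s}

/-- The bracket
`{O₁, O₂}(z) = 1/2 ∮_z dx (Ψ_{O₁}(x) O₂(z) - (-1)^{|O₁||O₂|} Ψ_{O₂}(x) O₁(z))`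
of operators of parities `p₁`, `p₂`. -/
def branchBracket (β : Branch) (p₁ p₂ : ZMod 2) (O₁ O₂ : V) : V :=
  (1 / 2 : ℂ) • (𝓥.mode 0 (𝓥.superpartner β O₁) O₂ -
    sgn (p₁ * p₂) • 𝓥.mode 0 (𝓥.superpartner β O₂) O₁)

/-- `W` is a superpotential for the `N = 2` superconformal raviolo vertex algebra. -/
structure IsSuperpotential (W : V) : Prop where
  /-- `W` is bosonic, of `R`-charge `2` and spin `1`. -/
  mem : W ∈ 𝓥.gr 0 2 1
  self : 𝓥.mode 0 W W ∈ LinearMap.range 𝓥.T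
  ope_Γ : 𝓥.HasOPE 𝓥.Γ W [𝓥.T W, W]
  ope_σ : 𝓥.HasOPE 𝓥.σ W []
  Qp : 𝓥.mode 0 W 𝓥.Qp = 0
  Qm : 𝓥.mode 0 W 𝓥.Qm = 0

/-- `D_W = W_(0)`. -/
def DW (W : V) : V →ₗ[ℂ] V := 𝓥.mode 0 W

end N2SuperconformalRVA

end

/-!
Everything follows from four families of mode identities, read off by comparing coefficients of
the three expansions of an element of `𝒦_{z,w,z-w}`: the graded commutator of two singular modes
(`commutator`), the derivation property of singular modes on the normally-ordered product
(`mode_nop`), the graded commutativity and associativity of that product on the whole vertex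
algebra (`nop_comm`, `nop_assoc`), and a special case of skew-symmetry (`zero_mode_symm`).

The superpotential: since `D_W = W_(0)` commutes with the singular modes of `Γ` and `σ` and
anticommutes with those of `Q^±`, it preserves branch primaries and anticommutes with `O ↦ Ψ_O`.
As a zero mode it is a derivation of all products, and `2 D_W ^ 2 = -(W_(0) W)_(0)` vanishes
because `W_(0) W` is a total derivative.

The bracket: applying the commutator `[Q^±_(0), Q^∓_(1)]` to a nonzero branch primary of spin `j`
and `S`-charge `q` gives `q = ± 2 j` (`IsBranchPrimary.charge_eq`), so branch primaries saturate
the BPS bound. By the BPS bound the operator product of two primaries is then regular, and that of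
a superpartner with a primary has only the term `Ω^0`. Two consequences carry the proof. First,
`(Ψ_{O₁})_(0) O₂` is again a branch primary (`IsBranchPrimary.bracket`). Second, acting with the
zero mode of the supercharge on `(O₁)_(0) O₂ = 0` and using skew-symmetry, `(Ψ_{O₁})_(0) O₂` is
already graded skew-symmetric (`superpartner_mode_skew`), so that the bracket is `{O₁, O₂} =
(Ψ_{O₁})_(0) O₂` (`branchBracket_eq`). In this form it is defined on all vectors, and the Leibniz
rule and the Jacobi identity are the derivation properties of zero modes, since `{O₁, O₂}` has
superpartner `± (Ψ_{O₁})_(0) Ψ_{O₂}`.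

The grading: on branch primaries the degree `r ± q` equals `r + 2 j`, a function of the `R`-charge
and the spin, so independence of the parts of the chiral ring is inherited from the grading of the
vertex algebra (`iSupIndep_chiralRingPart`).
-/

/-! ### Linear algebra -/

section LinearAlgebra

variable {R M : Type*} [CommRing R] [AddCommGroup M] [Module R M]

lemma LinearMap.apply_mem_of_mem_span {S T : Set M} {U : Submodule R M} (B : M →ₗ[R] M →ₗ[R] M)
    (h : ∀ x ∈ S, ∀ y ∈ T, B x y ∈ U) {x y : M} (hx : x ∈ Submodule.span R S)
    (hy : y ∈ Submodule.span R T) : B x y ∈ U := by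
  have hle : Submodule.map₂ B (Submodule.span R S) (Submodule.span R T) ≤ U := by
    rw [Submodule.map₂_span_span, Submodule.span_le]
    rintro _ ⟨x, hx, y, hy, rfl⟩
    exact h x hx y hy
  exact hle (Submodule.apply_mem_map₂ B hx hy)

/-- The restriction of a bilinear map to an invariant submodule. -/
def LinearMap.restrict₂ (B : M →ₗ[R] M →ₗ[R] M) (U : Submodule R M)
    (h : ∀ a ∈ U, ∀ b ∈ U, B a b ∈ U) : U →ₗ[R] U →ₗ[R] U :=
  LinearMap.mk₂ R (fun a b => ⟨B a b, h a a.2 b b.2⟩)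
    (fun _ _ _ => by ext; simp) (fun _ _ _ => by ext; simp)
    (fun _ _ _ => by ext; simp) (fun _ _ _ => by ext; simp)

/-- Independent submodules with supremum `U`, restricted to `U`, are a grading of `U`. -/
lemma DirectSum.isInternal_comap_subtype {ι : Type*} [DecidableEq ι] {A : ι → Submodule R M}
    {U : Submodule R M} (hA : iSupIndep A) (hU : ⨆ i, A i = U) :
    DirectSum.IsInternal fun i => (A i).comap U.subtype := by
  have hle (i : ι) : A i ≤ U := hU ▸ le_iSup A i
  have hmap (i : ι) : ((A i).comap U.subtype).map U.subtype = A i := by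
    rw [Submodule.map_comap_subtype, inf_eq_right.2 (hle i)]
  refine (DirectSum.isInternal_submodule_iff_iSupIndep_and_iSup_eq_top _).2 ⟨fun i => ?_, ?_⟩
  · rw [Submodule.disjoint_def]
    intro x hx hx'
    have h := Submodule.mem_map_of_mem (f := U.subtype) hx'
    simp only [Submodule.map_iSup, hmap] at h
    exact Subtype.ext (Submodule.disjoint_def.1 (hA i) x hx h)
  · apply Submodule.map_injective_of_injective U.injective_subtype
    simp only [Submodule.map_iSup, hmap, hU, Submodule.map_top, Submodule.range_subtype]

lemma Module.Dual.eq_of_forall_apply_eq (K : Type*) {V : Type*} [Field K] [AddCommGroup V]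
    [Module K V] {x y : V} (h : ∀ φ : Module.Dual K V, φ x = φ y) : x = y :=
  sub_eq_zero.1 <| (Module.forall_dual_apply_eq_zero_iff K (x - y)).1 fun φ => by
    rw [map_sub, h φ, sub_self]

end LinearAlgebra

/-! ### Signs -/

namespace Raviolo

@[simp] lemma sgn_zero : sgn 0 = 1 := by simp [sgn]

@[simp] lemma sgn_one : sgn 1 = -1 := by simp [sgn]

@[simp] lemma symPar_natCast (n : ℕ) : symPar n = 1 := if_pos (Int.natCast_nonneg n)

@[simp] lemma symPar_zero : symPar 0 = 1 := rfl

@[simp] lemma symPar_negSucc (n : ℕ) : symPar (Int.negSucc n) = 0 := rfl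

@[simp] lemma symPar_neg_one : symPar (-1) = 0 := rfl

lemma zmod_two_cases (p : ZMod 2) : p = 0 ∨ p = 1 := by
  revert p; decide

lemma sgn_add (p q : ZMod 2) : sgn (p + q) = sgn p * sgn q := by
  rcases zmod_two_cases p with rfl | rfl <;> rcases zmod_two_cases q with rfl | rfl <;>
    simp [show (1 + 1 : ZMod 2) = 0 from rfl]

lemma sgn_mul_sgn_self (p : ZMod 2) : sgn p * sgn p = 1 := by
  rcases zmod_two_cases p with rfl | rfl <;> simp

lemma Branch.sign_mul_sign (β : Branch) : β.sign * β.sign = 1 := by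
  cases β <;> simp [Branch.sign]

end Raviolo

/-! ### Mode identities from locality and associativity -/

namespace RavioloVertexAlgebra

open Raviolo

variable {V : Type*} [AddCommGroup V] [Module ℂ V] (𝓡 : RavioloVertexAlgebra V)

/-- The space of vectors of parity `p`. -/
def par (p : ZMod 2) : Submodule ℂ V := ⨆ r, ⨆ j, 𝓡.gr p r j

variable {𝓡}

lemma mem_par {p : ZMod 2} {r j : ℝ} {a : V} (h : a ∈ 𝓡.gr p r j) : a ∈ 𝓡.par p :=
  Submodule.mem_iSup_of_mem r (Submodule.mem_iSup_of_mem j h)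

@[elab_as_elim]
lemma par_induction {P : V → Prop} (mem : ∀ p, ∀ x ∈ 𝓡.par p, P x) (zero : P 0)
    (add : ∀ x y, P x → P y → P (x + y)) (x : V) : P x :=
  Submodule.iSup_induction (motive := P) (fun i : ZMod 2 × ℝ × ℝ => 𝓡.gr i.1 i.2.1 i.2.2)
    (by rw [𝓡.isInternal.submodule_iSup_eq_top]; trivial)
    (fun i y hy => mem i.1 y (mem_par hy)) zero add

lemma mode_mem_par {p q : ZMod 2} {a b : V} (n : ℤ) (ha : a ∈ 𝓡.par p) (hb : b ∈ 𝓡.par q) :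
    𝓡.mode n a b ∈ 𝓡.par (p + q + symPar n) := by
  have h : Submodule.map₂ (𝓡.mode n) (𝓡.par p) (𝓡.par q) ≤ 𝓡.par (p + q + symPar n) := by
    simp only [par, Submodule.map₂_iSup_left, Submodule.map₂_iSup_right, iSup_le_iff]
    intro r j r' j'
    exact Submodule.map₂_le.2 fun x hx y hy => mem_par (𝓡.mode_mem n hx hy)
  exact h (Submodule.apply_mem_map₂ _ ha hb)

variable {p q : ZMod 2} {a b : V}

lemma exists_confFun (ha : a ∈ 𝓡.par p) (hb : b ∈ 𝓡.par q) (v : V) (φ : Module.Dual ℂ V) :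
    ∃ f : ConfFun, ∀ m n : ℤ,
      sgn ((p + symPar m) * symPar n) * φ (𝓡.mode m a (𝓡.mode n b v)) = f.expandZW m n ∧
      sgn (p * q + q * symPar m) * φ (𝓡.mode n b (𝓡.mode m a v)) = f.expandWZ m n ∧
      φ (𝓡.mode n (𝓡.mode m a b) v) = f.expandDW m n := by
  obtain ⟨N, hN⟩ := 𝓡.locality p q a b ha hb
  obtain ⟨f, -, hf⟩ := hN v φ
  exact ⟨f, hf⟩

/-- The graded commutator of two singular modes: the comparison of the coefficients of
`Ω_z^m Ω_w^n` in the expansions for small `w` and for small `z`. -/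
lemma commutator (ha : a ∈ 𝓡.par p) (hb : b ∈ 𝓡.par q) (m n : ℕ) (v : V) :
    sgn (p + 1) • 𝓡.mode m a (𝓡.mode n b v) - sgn ((p + 1) * q) • 𝓡.mode n b (𝓡.mode m a v) =
      ∑ l ∈ Finset.range (m + 1),
        (m.choose l : ℂ) • 𝓡.mode ((n + (m - l) : ℕ) : ℤ) (𝓡.mode l a b) v := by
  refine Module.Dual.eq_of_forall_apply_eq ℂ fun φ => ?_
  obtain ⟨f, hf⟩ := exists_confFun ha hb v φ
  have h := hf (Int.ofNat m) (Int.ofNat n)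
  have e₁ := h.1
  have e₂ := h.2.1
  simp only [symPar_natCast, ConfFun.expandZW, ConfFun.expandWZ, Int.ofNat_eq_natCast,
    mul_one] at e₁ e₂
  rw [show p * q + q = (p + 1) * q by ring] at e₂
  simp only [map_sub, map_smul, smul_eq_mul, map_sum, e₁, e₂, add_sub_cancel_left]
  refine Finset.sum_congr rfl fun l _ => ?_
  exact congrArg _ (hf (Int.ofNat l) (Int.ofNat (n + (m - l)))).2.2.symm

/-- The graded commutator of the zero mode of `a` with the regular modes of `b`, which index the
powers `w ^ n`. -/
lemma zero_mode_regular (ha : a ∈ 𝓡.par p) (hb : b ∈ 𝓡.par q) (n : ℕ) (v : V) :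
    𝓡.mode 0 a (𝓡.mode (Int.negSucc n) b v) =
      𝓡.mode (Int.negSucc n) (𝓡.mode 0 a b) v +
        sgn ((p + 1) * q) • 𝓡.mode (Int.negSucc n) b (𝓡.mode 0 a v) := by
  refine Module.Dual.eq_of_forall_apply_eq ℂ fun φ => ?_
  obtain ⟨f, hf⟩ := exists_confFun ha hb v φ
  have h := hf (Int.ofNat 0) (Int.negSucc n)
  have e₁ := h.1
  have e₂ := h.2.1
  have e₃ := (hf (Int.ofNat 0) (Int.negSucc n)).2.2
  simp only [symPar_zero, symPar_negSucc, ConfFun.expandZW, ConfFun.expandWZ, ConfFun.expandDW,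
    Int.ofNat_eq_natCast, Nat.cast_zero, mul_one, mul_zero, sgn_zero, one_mul] at e₁ e₂ e₃
  rw [show p * q + q = (p + 1) * q by ring] at e₂
  rw [map_add, map_smul, smul_eq_mul, e₁, e₂, e₃, add_comm]
  congr 1
  rw [Finsupp.sum_eq_single 0]
  · simp
  · intro l _ hl
    simp [hl]
  · simp

/-- Singular modes are derivations of the normally-ordered product. -/
lemma mode_nop (ha : a ∈ 𝓡.par p) (hb : b ∈ 𝓡.par q) (m : ℕ) (v : V) :
    𝓡.mode m a (𝓡.mode (-1) b v) =
      𝓡.mode (-1) (𝓡.mode m a b) v + sgn ((p + 1) * q) • 𝓡.mode (-1) b (𝓡.mode m a v) := by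
  refine Module.Dual.eq_of_forall_apply_eq ℂ fun φ => ?_
  obtain ⟨f, hf⟩ := exists_confFun ha hb v φ
  have h := hf (Int.ofNat m) (Int.negSucc 0)
  have e₁ := h.1
  have e₂ := h.2.1
  have e₃ := h.2.2
  simp only [symPar_natCast, symPar_neg_one, ConfFun.expandZW, ConfFun.expandWZ, ConfFun.expandDW,
    Int.ofNat_eq_natCast, mul_one, mul_zero, sgn_zero, one_mul,
    show Int.negSucc 0 = -1 from rfl] at e₁ e₂ e₃
  rw [show p * q + q = (p + 1) * q by ring] at e₂
  rw [map_add, map_smul, smul_eq_mul, e₁, e₂, e₃, add_comm]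
  congr 1
  rw [Finsupp.sum_eq_single m]
  · simp
  · intro l _ hl
    exact if_neg fun h => hl (le_antisymm h.1 (by simpa using h.2))
  · simp

lemma nop_nop_comm (ha : a ∈ 𝓡.par p) (hb : b ∈ 𝓡.par q) (v : V) :
    𝓡.mode (-1) a (𝓡.mode (-1) b v) = sgn (p * q) • 𝓡.mode (-1) b (𝓡.mode (-1) a v) := by
  refine Module.Dual.eq_of_forall_apply_eq ℂ fun φ => ?_
  obtain ⟨f, hf⟩ := exists_confFun ha hb v φ
  have h := hf (Int.negSucc 0) (Int.negSucc 0)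
  have e₁ := h.1
  have e₂ := h.2.1
  simp only [symPar_neg_one, ConfFun.expandZW, ConfFun.expandWZ, mul_zero, sgn_zero, one_mul,
    add_zero, show Int.negSucc 0 = -1 from rfl] at e₁ e₂
  rw [map_smul, smul_eq_mul, e₁, e₂]

lemma nop_comm (ha : a ∈ 𝓡.par p) (hb : b ∈ 𝓡.par q) :
    𝓡.mode (-1) a b = sgn (p * q) • 𝓡.mode (-1) b a := by
  simpa only [𝓡.create] using nop_nop_comm ha hb 𝓡.vac

lemma nop_assoc (ha : a ∈ 𝓡.par p) (hb : b ∈ 𝓡.par q) (v : V) :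
    𝓡.mode (-1) (𝓡.mode (-1) a b) v = 𝓡.mode (-1) a (𝓡.mode (-1) b v) := by
  refine Module.Dual.eq_of_forall_apply_eq ℂ fun φ => ?_
  obtain ⟨f, hf⟩ := exists_confFun ha hb v φ
  have h := hf (Int.negSucc 0) (Int.negSucc 0)
  have e₁ := h.1
  have e₂ := h.2.2
  simp only [symPar_neg_one, ConfFun.expandZW, ConfFun.expandDW, mul_zero, sgn_zero, one_mul,
    show Int.negSucc 0 = -1 from rfl] at e₁ e₂
  rw [e₁, e₂]
  simp

/-- Skew-symmetry of the zero mode when no higher singular mode contributes the usual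
translation terms. -/
lemma zero_mode_symm (ha : a ∈ 𝓡.par p) (hb : b ∈ 𝓡.par q)
    (hab : ∀ l : ℕ, 𝓡.mode (l + 1 : ℕ) a b = 0) :
    𝓡.mode 0 b a = sgn (p * q) • 𝓡.mode 0 a b := by
  -- On the vacuum `a_(-1) b_(0)` vanishes, so `b_(0) a_(-1)`, whose value there is `b_(0) a`, comes
  -- from the pole part in `z - w` alone.
  refine Module.Dual.eq_of_forall_apply_eq ℂ fun φ => ?_
  obtain ⟨f, hf⟩ := exists_confFun ha hb 𝓡.vac φ
  have h := hf (Int.negSucc 0) (Int.ofNat 0)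
  have e₁ := h.1
  have e₂ := h.2.1
  have e₃ := (hf (Int.ofNat 0) (Int.negSucc 0)).2.2
  simp only [symPar_neg_one, ConfFun.expandZW, ConfFun.expandWZ, ConfFun.expandDW, mul_zero,
    Int.ofNat_eq_natCast, Nat.cast_zero, add_zero, 𝓡.create, 𝓡.mode_vac b 0 le_rfl, map_zero,
    show Int.negSucc 0 = -1 from rfl] at e₁ e₂ e₃
  rw [← e₁, zero_add, Finsupp.sum_eq_single 0] at e₂
  · simp only [le_refl, if_true, pow_zero, Nat.choose_self, Nat.cast_one, one_mul, ← e₃] at e₂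
    rw [map_smul, smul_eq_mul, ← e₂, ← mul_assoc, sgn_mul_sgn_self, one_mul]
  · intro l _ hl
    obtain ⟨l, rfl⟩ := Nat.exists_eq_succ_of_ne_zero hl
    have e := (hf (Int.ofNat (l + 1)) (Int.negSucc (l + 1))).2.2
    have hl := hab l
    simp only [ConfFun.expandDW, Int.ofNat_eq_natCast, hl, map_zero, LinearMap.zero_apply] at e
    simp [← e]
  · simp

lemma zero_mode_singular (ha : a ∈ 𝓡.par p) (hb : b ∈ 𝓡.par q) (n : ℕ) (v : V) :
    sgn (p + 1) • 𝓡.mode 0 a (𝓡.mode n b v) - sgn ((p + 1) * q) • 𝓡.mode n b (𝓡.mode 0 a v) =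
      𝓡.mode n (𝓡.mode 0 a b) v := by
  simpa using commutator ha hb 0 n v

/-- Zero modes of odd vectors are derivations of all the products. -/
lemma zero_mode_of_odd (ha : a ∈ 𝓡.par 1) (hb : b ∈ 𝓡.par q) (n : ℤ) (v : V) :
    𝓡.mode 0 a (𝓡.mode n b v) = 𝓡.mode n (𝓡.mode 0 a b) v + 𝓡.mode n b (𝓡.mode 0 a v) := by
  have h2 : (1 + 1 : ZMod 2) = 0 := rfl
  rcases n with n | n
  · have h := zero_mode_singular ha hb n v
    simp only [h2, zero_mul, sgn_zero, one_smul] at h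
    exact sub_eq_iff_eq_add.1 h
  · simpa [h2] using zero_mode_regular ha hb n v

/-- Zero modes of even vectors anticommute with singular modes up to the zero mode product. -/
lemma zero_mode_of_even (ha : a ∈ 𝓡.par 0) (hb : b ∈ 𝓡.par q) (n : ℕ) (v : V) :
    𝓡.mode 0 a (𝓡.mode n b v) =
      -𝓡.mode n (𝓡.mode 0 a b) v - sgn q • 𝓡.mode n b (𝓡.mode 0 a v) := by
  have h := zero_mode_singular ha hb n v
  simp only [zero_add, sgn_one, one_mul, neg_smul, one_smul] at h
  rw [← h]; abel

/-- When the operator product of `a` and `b` is regular, their singular modes supercommute, so the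
modes of `b` preserve the kernels of the modes of `a`. -/
lemma mode_mode_eq_zero (ha : a ∈ 𝓡.par p) (hb : b ∈ 𝓡.par q)
    (hab : ∀ l : ℕ, 𝓡.mode l a b = 0) (m n : ℕ) {v : V} (hv : 𝓡.mode m a v = 0) :
    𝓡.mode m a (𝓡.mode n b v) = 0 := by
  have h := commutator ha hb m n v
  rw [Finset.sum_eq_zero (fun l _ => by simp [hab l]), hv, map_zero, smul_zero, sub_zero] at h
  refine (smul_eq_zero.1 h).resolve_left fun h0 => ?_
  simpa [h0] using sgn_mul_sgn_self (p + 1)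

end RavioloVertexAlgebra

/-! ### Primaries of the superconformal algebra -/

namespace N2SuperconformalRVA

open Raviolo RavioloVertexAlgebra

variable {V : Type*} [AddCommGroup V] [Module ℂ V] {𝓥 : N2SuperconformalRVA V}
  {β : Branch} {p p₁ p₂ : ZMod 2} {s s₁ s₂ r r₁ r₂ j j₁ j₂ q q₁ q₂ : ℝ} {O O₁ O₂ W a b : V}

lemma Qreg_mem (β : Branch) : 𝓥.Qreg β ∈ 𝓥.gr 0 1 (3 / 2) := by
  cases β
  exacts [𝓥.Qp_mem, 𝓥.Qm_mem]

lemma Qdesc_mem (β : Branch) : 𝓥.Qdesc β ∈ 𝓥.gr 0 1 (3 / 2) := by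
  cases β
  exacts [𝓥.Qm_mem, 𝓥.Qp_mem]

lemma hasOPE_Γ_Qdesc (β : Branch) :
    𝓥.HasOPE 𝓥.Γ (𝓥.Qdesc β) [𝓥.T (𝓥.Qdesc β), ((3 / 2 : ℝ) : ℂ) • 𝓥.Qdesc β] := by
  have : ((3 / 2 : ℝ) : ℂ) = 3 / 2 := by norm_num
  rw [this]
  cases β
  exacts [𝓥.ope_ΓQm, 𝓥.ope_ΓQp]

lemma hasOPE_σ_Qreg (β : Branch) :
    𝓥.HasOPE 𝓥.σ (𝓥.Qreg β) [((β.sign : ℝ) : ℂ) • 𝓥.Qreg β] := by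
  cases β
  · simpa [Qreg, Qdesc, Branch.sign] using 𝓥.ope_σQp
  · simpa [Qreg, Qdesc, Branch.sign] using 𝓥.ope_σQm

lemma hasOPE_σ_Qdesc (β : Branch) :
    𝓥.HasOPE 𝓥.σ (𝓥.Qdesc β) [((-β.sign : ℝ) : ℂ) • 𝓥.Qdesc β] := by
  cases β
  · simpa [Qreg, Qdesc, Branch.sign] using 𝓥.ope_σQm
  · simpa [Qreg, Qdesc, Branch.sign] using 𝓥.ope_σQp

lemma Qdesc_Qdesc (β : Branch) (n : ℕ) : 𝓥.mode n (𝓥.Qdesc β) (𝓥.Qdesc β) = 0 := by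
  cases β
  · simpa [Qdesc] using 𝓥.ope_QmQm n
  · simpa [Qdesc] using 𝓥.ope_QpQp n

lemma Qreg_zero_Qdesc (β : Branch) :
    𝓥.mode 0 (𝓥.Qreg β) (𝓥.Qdesc β) =
      -𝓥.Γ - ((β.sign / 2 : ℝ) : ℂ) • 𝓥.T 𝓥.σ := by
  cases β
  · simpa [Qreg, Qdesc, Branch.sign] using 𝓥.ope_QpQm 0
  · simpa [Qreg, Qdesc, Branch.sign, neg_div, sub_eq_add_neg] using 𝓥.ope_QmQp 0

lemma mode_T (b : V) (n : ℤ) (v : V) :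
    𝓥.mode n (𝓥.T b) v = -(n : ℂ) • 𝓥.mode (n - 1) b v := by
  induction b using par_induction (𝓡 := 𝓥.toRavioloVertexAlgebra) with
  | mem p x hx =>
    have h := zero_mode_of_odd (mem_par 𝓥.Γ_mem) hx n v
    rw [𝓥.Γ_zero, 𝓥.Γ_zero, 𝓥.Γ_zero] at h
    rw [← 𝓥.translation, h, add_sub_cancel_right]
  | zero => simp
  | add x y hx hy => simp only [map_add, LinearMap.add_apply, hx, hy, smul_add]

lemma zero_mode_T (b v : V) : 𝓥.mode 0 (𝓥.T b) v = 0 := by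
  simp [mode_T]

lemma superpartner_mem_par (hb : b ∈ 𝓥.par p) : 𝓥.superpartner β b ∈ 𝓥.par (p + 1) := by
  simpa [superpartner] using mode_mem_par 0 (mem_par (Qdesc_mem β)) hb

lemma superpartner_mem (hb : b ∈ 𝓥.gr p r j) :
    𝓥.superpartner β b ∈ 𝓥.gr (p + 1) r (j + 1 / 2) := by
  have h := 𝓥.mode_mem 0 (Qdesc_mem β) hb
  rw [symPar_zero, zero_add] at h
  have e₁ : 1 + r - symDeg 0 = r := by simp [symDeg]
  have e₂ : 3 / 2 + j - ((0 : ℤ) : ℝ) - 1 = j + 1 / 2 := by push_cast; ring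
  rwa [e₁, e₂] at h

/-- The `S`-charge is additive under all products. -/
lemma σ_zero_mode (ha : a ∈ 𝓥.par p) (h₁ : 𝓥.mode 0 𝓥.σ a = (q₁ : ℂ) • a)
    (h₂ : 𝓥.mode 0 𝓥.σ b = (q₂ : ℂ) • b) (n : ℤ) :
    𝓥.mode 0 𝓥.σ (𝓥.mode n a b) = ((q₁ + q₂ : ℝ) : ℂ) • 𝓥.mode n a b := by
  rw [zero_mode_of_odd (mem_par 𝓥.σ_mem) ha, h₁, h₂]
  simp [add_smul]

/-- Commutator of the singular modes of `σ` with the zero mode of a `σ`-primary. -/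
lemma σ_mode_zero_mode (hb : b ∈ 𝓥.par p) (h : 𝓥.HasOPE 𝓥.σ b [(q : ℂ) • b]) (m : ℕ) (v : V) :
    𝓥.mode m 𝓥.σ (𝓥.mode 0 b v) =
      𝓥.mode 0 b (𝓥.mode m 𝓥.σ v) + (q : ℂ) • 𝓥.mode m b v := by
  have h2 : (1 + 1 : ZMod 2) = 0 := rfl
  have hc := commutator (mem_par 𝓥.σ_mem) hb m 0 v
  rw [Finset.sum_range_succ', Finset.sum_eq_zero
    (fun l _ => by rw [h (l + 1)]; simp), h 0] at hc
  simp only [h2, zero_mul, sgn_zero, one_smul, Nat.cast_zero] at hc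
  rw [sub_eq_iff_eq_add'.1 hc]
  simp

/-- Commutator of the higher modes of `Γ` with the zero mode of a `Γ`-primary. -/
lemma Γ_mode_zero_mode (hb : b ∈ 𝓥.par p) (h : 𝓥.HasOPE 𝓥.Γ b [𝓥.T b, (j : ℂ) • b]) (m : ℕ)
    (v : V) :
    𝓥.mode (m + 1 : ℕ) 𝓥.Γ (𝓥.mode 0 b v) =
      𝓥.mode 0 b (𝓥.mode (m + 1 : ℕ) 𝓥.Γ v) +
        ((m + 1) * (j - 1) : ℂ) • 𝓥.mode m b v := by
  have h2 : (1 + 1 : ZMod 2) = 0 := rfl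
  have hc := commutator (mem_par 𝓥.Γ_mem) hb (m + 1) 0 v
  rw [Finset.sum_range_succ', Finset.sum_range_succ', Finset.sum_eq_zero
    (fun l _ => by rw [h (l + 1 + 1)]; simp), h 0, h (0 + 1)] at hc
  simp only [h2, zero_mul, sgn_zero, one_smul, Nat.cast_zero] at hc
  rw [sub_eq_iff_eq_add'.1 hc]
  simp only [List.getD_cons_zero, List.getD_cons_succ, zero_add, Nat.choose_one_right,
    Nat.choose_zero_right, Nat.sub_zero, mode_T, Nat.add_sub_cancel, map_smul,
    LinearMap.smul_apply, smul_smul, Nat.cast_one, one_mul]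
  push_cast
  rw [add_sub_cancel_right, ← add_smul]
  congr 2
  ring

lemma IsBranchPrimary.σ_zero (h : 𝓥.IsBranchPrimary β p r j q O) :
    𝓥.mode 0 𝓥.σ O = (q : ℂ) • O := by
  simpa using h.primary.2 0

lemma IsBranchPrimary.σ_succ (h : 𝓥.IsBranchPrimary β p r j q O) (n : ℕ) :
    𝓥.mode (n + 1 : ℕ) 𝓥.σ O = 0 := by
  rw [h.primary.2 (n + 1)]; simp

lemma IsBranchPrimary.Γ_add_two (h : 𝓥.IsBranchPrimary β p r j q O) (n : ℕ) :
    𝓥.mode (n + 2 : ℕ) 𝓥.Γ O = 0 := by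
  rw [h.primary.1 (n + 2)]; simp

lemma IsBranchPrimary.Qreg_mode (h : 𝓥.IsBranchPrimary β p r j q O) (n : ℕ) :
    𝓥.mode n (𝓥.Qreg β) O = 0 := by
  rw [h.ope_Qreg n]; simp

lemma IsBranchPrimary.Qdesc_succ (h : 𝓥.IsBranchPrimary β p r j q O) (n : ℕ) :
    𝓥.mode (n + 1 : ℕ) (𝓥.Qdesc β) O = 0 := by
  rw [h.ope_Qdesc (n + 1)]; simp

lemma isSCPrimary_of_modes (hO : O ∈ 𝓥.gr p r j) (hσ₀ : 𝓥.mode 0 𝓥.σ O = (q : ℂ) • O)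
    (hσ : ∀ n : ℕ, 𝓥.mode (n + 1 : ℕ) 𝓥.σ O = 0)
    (hΓ : ∀ n : ℕ, 𝓥.mode (n + 2 : ℕ) 𝓥.Γ O = 0) : 𝓥.IsSCPrimary j q O := by
  constructor
  · rintro (_ | _ | n)
    · simpa using 𝓥.Γ_zero O
    · simpa using 𝓥.Γ_one hO
    · exact (hΓ n).trans (by simp)
  · rintro (_ | n)
    · simpa using hσ₀
    · simpa using hσ n

/-- A criterion for branch primaries: the conditions on the superpartner are automatic, as are the
leading coefficients of the operator product with `Γ`. -/
lemma isBranchPrimary_of_modes (hO : O ∈ 𝓥.gr p r j) (hσ₀ : 𝓥.mode 0 𝓥.σ O = (q : ℂ) • O)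
    (hσ : ∀ n : ℕ, 𝓥.mode (n + 1 : ℕ) 𝓥.σ O = 0)
    (hΓ : ∀ n : ℕ, 𝓥.mode (n + 2 : ℕ) 𝓥.Γ O = 0)
    (hr : ∀ n : ℕ, 𝓥.mode n (𝓥.Qreg β) O = 0)
    (hd : ∀ n : ℕ, 𝓥.mode (n + 1 : ℕ) (𝓥.Qdesc β) O = 0) :
    𝓥.IsBranchPrimary β p r j q O where
  mem := hO
  primary := isSCPrimary_of_modes hO hσ₀ hσ hΓ
  ope_Qreg n := by simpa using hr n
  ope_Qdesc := by
    rintro (_ | n)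
    · simp [superpartner]
    · simpa using hd n
  partner_mem := superpartner_mem hO
  partner_primary := by
    have hQ := mem_par (Qdesc_mem (𝓥 := 𝓥) β)
    refine isSCPrimary_of_modes (superpartner_mem hO) ?_ (fun n => ?_) (fun n => ?_)
    · have h := σ_mode_zero_mode hQ (hasOPE_σ_Qdesc β) 0 O
      rw [Nat.cast_zero, hσ₀, map_smul, ← add_smul] at h
      rw [superpartner, h]
      push_cast
      rw [sub_eq_add_neg]
    · rw [superpartner, σ_mode_zero_mode hQ (hasOPE_σ_Qdesc β), hσ, hd]
      simp
    · rw [superpartner, Γ_mode_zero_mode hQ (hasOPE_Γ_Qdesc β), hΓ, hd]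
      simp

lemma isBranchPrimary_zero : 𝓥.IsBranchPrimary β p r j q 0 := by
  apply isBranchPrimary_of_modes <;> simp

lemma isBranchPrimary_vac : 𝓥.IsBranchPrimary β 0 0 0 0 𝓥.vac :=
  isBranchPrimary_of_modes 𝓥.vac_mem (by simp [𝓥.mode_vac])
    (fun n => 𝓥.mode_vac _ _ (by positivity)) (fun n => 𝓥.mode_vac _ _ (by positivity))
    (fun n => 𝓥.mode_vac _ _ (by positivity))
    (fun n => 𝓥.mode_vac _ _ (by positivity))

/-- A nonzero branch primary saturates the BPS bound. This follows from the vanishing of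
`[Q^±_(0), Q^∓_(1)] O`, which is a nonzero multiple of `(j ∓ q / 2) O`. -/
lemma IsBranchPrimary.charge_eq (h : 𝓥.IsBranchPrimary β p r j q O) :
    O = 0 ∨ q = β.sign * (2 * j) := by
  have hc := zero_mode_of_even (mem_par (Qreg_mem (𝓥 := 𝓥) β)) (mem_par (Qdesc_mem β)) 1 O
  have hQ := h.Qreg_mode 0
  have hd := h.Qdesc_succ 0
  rw [zero_add] at hd
  rw [Nat.cast_zero] at hQ
  rw [hQ, hd, Qreg_zero_Qdesc] at hc
  simp only [map_zero, smul_zero, sub_zero, map_sub, map_neg, map_smul, LinearMap.sub_apply,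
    LinearMap.neg_apply, LinearMap.smul_apply, mode_T, Nat.cast_one,
    𝓥.Γ_one h.mem, Int.cast_one, sub_self, h.σ_zero] at hc
  have hc : ((j - β.sign / 2 * q : ℝ) : ℂ) • O = 0 := by
    rw [hc]; push_cast; module
  rw [smul_eq_zero] at hc
  refine hc.symm.imp_right fun hc => ?_
  have hc' : j - β.sign / 2 * q = 0 := by exact_mod_cast hc
  have := β.sign_mul_sign
  linear_combination (-2 * β.sign) * hc' - q * this

/-! ### The differential -/

/-- `D_W` anticommutes with the modes of the supercharges, because it annihilates them. -/
lemma mode_Q_DW (hW : 𝓥.IsSuperpotential W) {Q : V} (hQ : Q ∈ 𝓥.par 0)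
    (hWQ : 𝓥.mode 0 W Q = 0) (n : ℕ) (v : V) :
    𝓥.mode n Q (𝓥.DW W v) = -𝓥.DW W (𝓥.mode n Q v) := by
  have h := zero_mode_of_even (mem_par hW.mem) hQ n v
  rw [hWQ] at h
  simp [DW, h]

lemma DW_Qreg (hW : 𝓥.IsSuperpotential W) (β : Branch) : 𝓥.mode 0 W (𝓥.Qreg β) = 0 := by
  cases β
  exacts [hW.Qp, hW.Qm]

lemma DW_Qdesc (hW : 𝓥.IsSuperpotential W) (β : Branch) : 𝓥.mode 0 W (𝓥.Qdesc β) = 0 := by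
  cases β
  exacts [hW.Qm, hW.Qp]

lemma superpartner_DW (hW : 𝓥.IsSuperpotential W) (v : V) :
    𝓥.superpartner β (𝓥.DW W v) = -𝓥.DW W (𝓥.superpartner β v) :=
  mode_Q_DW hW (mem_par (Qdesc_mem β)) (DW_Qdesc hW β) 0 v

lemma IsBranchPrimary.DW (h : 𝓥.IsBranchPrimary β p r j q O) (hW : 𝓥.IsSuperpotential W) :
    𝓥.IsBranchPrimary β (p + 1) (r + 1) j q (𝓥.DW W O) := by
  have hΓ : 𝓥.HasOPE 𝓥.Γ W [𝓥.T W, ((1 : ℝ) : ℂ) • W] := by simpa using hW.ope_Γ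
  have hσ : 𝓥.HasOPE 𝓥.σ W [((0 : ℝ) : ℂ) • W] := by
    rintro (_ | n) <;> rw [hW.ope_σ] <;> simp
  have hσW (n : ℕ) : 𝓥.mode n 𝓥.σ (𝓥.DW W O) = 𝓥.DW W (𝓥.mode n 𝓥.σ O) := by
    rw [N2SuperconformalRVA.DW, σ_mode_zero_mode (mem_par hW.mem) hσ]
    simp
  refine isBranchPrimary_of_modes ?_ ?_ (fun n => ?_) (fun n => ?_) (fun n => ?_) (fun n => ?_)
  · have hm := 𝓥.mode_mem 0 hW.mem h.mem
    have e₁ : (0 + p + symPar 0 : ZMod 2) = p + 1 := by simp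
    have e₂ : 2 + r - symDeg 0 = r + 1 := by simp only [symDeg, le_refl, if_true]; ring
    have e₃ : 1 + j - ((0 : ℤ) : ℝ) - 1 = j := by push_cast; ring
    rwa [e₁, e₂, e₃] at hm
  · simpa [h.σ_zero] using hσW 0
  · rw [hσW, h.σ_succ, map_zero]
  · rw [N2SuperconformalRVA.DW, Γ_mode_zero_mode (mem_par hW.mem) hΓ, h.Γ_add_two]
    simp
  · rw [mode_Q_DW hW (mem_par (Qreg_mem β)) (DW_Qreg hW β), h.Qreg_mode, map_zero, neg_zero]
  · rw [mode_Q_DW hW (mem_par (Qdesc_mem β)) (DW_Qdesc hW β), h.Qdesc_succ, map_zero, neg_zero]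

/-! ### Products and the BPS bound -/

lemma IsBranchPrimary.nop (h₁ : 𝓥.IsBranchPrimary β p₁ r₁ j₁ q₁ O₁)
    (h₂ : 𝓥.IsBranchPrimary β p₂ r₂ j₂ q₂ O₂) :
    𝓥.IsBranchPrimary β (p₁ + p₂) (r₁ + r₂) (j₁ + j₂) (q₁ + q₂) (𝓥.mode (-1) O₁ O₂) := by
  -- A singular mode annihilating both factors annihilates their product.
  have key {s : ZMod 2} {c : V} (hc : c ∈ 𝓥.par s) (n : ℕ) (e₁ : 𝓥.mode n c O₁ = 0)
      (e₂ : 𝓥.mode n c O₂ = 0) : 𝓥.mode n c (𝓥.mode (-1) O₁ O₂) = 0 := by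
    rw [mode_nop hc (mem_par h₁.mem), e₁, e₂]
    simp
  refine isBranchPrimary_of_modes ?_
    (σ_zero_mode (mem_par h₁.mem) h₁.σ_zero h₂.σ_zero _)
    (fun n => key (mem_par 𝓥.σ_mem) _ (h₁.σ_succ n) (h₂.σ_succ n))
    (fun n => key (mem_par 𝓥.Γ_mem) _ (h₁.Γ_add_two n) (h₂.Γ_add_two n))
    (fun n => key (mem_par (Qreg_mem β)) _ (h₁.Qreg_mode n) (h₂.Qreg_mode n))
    (fun n => key (mem_par (Qdesc_mem β)) _ (h₁.Qdesc_succ n) (h₂.Qdesc_succ n))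
  have hm := 𝓥.mode_mem (-1) h₁.mem h₂.mem
  have e₂ : r₁ + r₂ - symDeg (-1) = r₁ + r₂ := by simp [symDeg]
  have e₃ : j₁ + j₂ - ((-1 : ℤ) : ℝ) - 1 = j₁ + j₂ := by push_cast; ring
  rwa [symPar_neg_one, add_zero, e₂, e₃] at hm

/-- The BPS bound, for an `S`-charge measured in the direction of the branch. -/
lemma SatisfiesBPS.eq_zero (hBPS : 𝓥.SatisfiesBPS) (hO : O ∈ 𝓥.gr p r j)
    (hσ : 𝓥.mode 0 𝓥.σ O = (q : ℂ) • O) {c : ℝ} (hq : q = β.sign * c) (hj : j < c / 2) :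
    O = 0 := by
  have hc : c ≤ |q| := by
    rw [hq]
    cases β
    · simpa [Branch.sign] using le_abs_self c
    · simpa [Branch.sign] using le_abs_self c
  have h := hBPS p r j q (by linarith)
  rw [← Submodule.mem_bot ℂ, ← h]
  exact ⟨hO, Module.End.mem_eigenspace_iff.2 hσ⟩

/-- The operator product of two branch primaries is regular. -/
lemma SatisfiesBPS.mode_eq_zero (hBPS : 𝓥.SatisfiesBPS) (h₁ : 𝓥.IsBranchPrimary β p₁ r₁ j₁ q₁ O₁)
    (h₂ : 𝓥.IsBranchPrimary β p₂ r₂ j₂ q₂ O₂) (n : ℕ) : 𝓥.mode n O₁ O₂ = 0 := by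
  rcases h₁.charge_eq with rfl | e₁
  · simp
  rcases h₂.charge_eq with rfl | e₂
  · simp
  refine hBPS.eq_zero (β := β) (𝓥.mode_mem n h₁.mem h₂.mem)
    (σ_zero_mode (mem_par h₁.mem) h₁.σ_zero h₂.σ_zero n) (c := 2 * (j₁ + j₂)) ?_ ?_
  · rw [e₁, e₂]; ring
  · have : (0 : ℝ) ≤ n := Nat.cast_nonneg n
    push_cast
    linarith

lemma IsBranchPrimary.partner_σ_zero (h : 𝓥.IsBranchPrimary β p r j q O) :
    𝓥.mode 0 𝓥.σ (𝓥.superpartner β O) = ((q - β.sign : ℝ) : ℂ) • 𝓥.superpartner β O := by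
  simpa using h.partner_primary.2 0

/-- The operator product of a superpartner with a branch primary has at most a simple pole. -/
lemma SatisfiesBPS.superpartner_mode_succ (hBPS : 𝓥.SatisfiesBPS)
    (h₁ : 𝓥.IsBranchPrimary β p₁ r₁ j₁ q₁ O₁) (h₂ : 𝓥.IsBranchPrimary β p₂ r₂ j₂ q₂ O₂) (n : ℕ) :
    𝓥.mode (n + 1 : ℕ) (𝓥.superpartner β O₁) O₂ = 0 := by
  rcases h₁.charge_eq with rfl | e₁
  · simp
  rcases h₂.charge_eq with rfl | e₂
  · simp
  refine hBPS.eq_zero (β := β) (𝓥.mode_mem _ h₁.partner_mem h₂.mem)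
    (σ_zero_mode (mem_par h₁.partner_mem) h₁.partner_σ_zero h₂.σ_zero _)
    (c := 2 * (j₁ + j₂) - 1) ?_ ?_
  · rw [e₁, e₂]; ring
  · have : (0 : ℝ) ≤ n := Nat.cast_nonneg n
    push_cast
    linarith

/-! ### The descent bracket -/

lemma superpartner_superpartner (v : V) : 𝓥.superpartner β (𝓥.superpartner β v) = 0 := by
  have h := zero_mode_of_even (mem_par (Qdesc_mem (𝓥 := 𝓥) β)) (mem_par (Qdesc_mem β)) 0 v
  have h0 := Qdesc_Qdesc (𝓥 := 𝓥) β 0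
  rw [Nat.cast_zero] at h h0
  rw [h0, sgn_zero, one_smul, map_zero, LinearMap.zero_apply, neg_zero, zero_sub,
    eq_neg_iff_add_eq_zero, ← two_smul ℂ] at h
  exact (smul_eq_zero.1 h).resolve_left two_ne_zero

lemma IsBranchPrimary.Qdesc_superpartner (h : 𝓥.IsBranchPrimary β p r j q O) (n : ℕ) :
    𝓥.mode n (𝓥.Qdesc β) (𝓥.superpartner β O) = 0 := by
  rcases n with _ | n
  · exact superpartner_superpartner O
  · exact mode_mode_eq_zero (mem_par (Qdesc_mem β)) (mem_par (Qdesc_mem β)) (Qdesc_Qdesc β) _ 0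
      (h.Qdesc_succ n)

/-- Descent is inverted, up to a derivative, by the other supercharge. -/
lemma IsBranchPrimary.Qreg_zero_superpartner (h : 𝓥.IsBranchPrimary β p r j q O) :
    𝓥.mode 0 (𝓥.Qreg β) (𝓥.superpartner β O) = 𝓥.T O := by
  have hc := zero_mode_of_even (mem_par (Qreg_mem (𝓥 := 𝓥) β)) (mem_par (Qdesc_mem β)) 0 O
  have hQ := h.Qreg_mode 0
  rw [Nat.cast_zero] at hQ hc
  rw [hQ, Qreg_zero_Qdesc] at hc
  rw [superpartner, hc]
  simp [zero_mode_T, 𝓥.Γ_zero]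

/-- The descent bracket of branch primaries is a branch primary. The modes of `Γ`, `σ`
and the descending supercharge commute with `Ψ_(0)` up to signs and higher modes of `Ψ`, which
vanish by the BPS bound; the higher modes of the regular supercharge are excluded by the BPS bound
directly, and its zero mode maps `Ψ` to a total derivative. -/
lemma IsBranchPrimary.bracket (hBPS : 𝓥.SatisfiesBPS) (h₁ : 𝓥.IsBranchPrimary β p₁ r₁ j₁ q₁ O₁)
    (h₂ : 𝓥.IsBranchPrimary β p₂ r₂ j₂ q₂ O₂) :
    𝓥.IsBranchPrimary β (p₁ + p₂) (r₁ + r₂ - 1) (j₁ + j₂ - 1 / 2) (q₁ + q₂ - β.sign)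
      (𝓥.mode 0 (𝓥.superpartner β O₁) O₂) := by
  rcases h₁.charge_eq with rfl | e₁
  · simpa using isBranchPrimary_zero
  rcases h₂.charge_eq with rfl | e₂
  · simpa using isBranchPrimary_zero
  have hΨ := mem_par h₁.partner_mem
  have hmem : 𝓥.mode 0 (𝓥.superpartner β O₁) O₂ ∈
      𝓥.gr (p₁ + p₂) (r₁ + r₂ - 1) (j₁ + j₂ - 1 / 2) := by
    have hm := 𝓥.mode_mem 0 h₁.partner_mem h₂.mem
    have e₁ : (p₁ + 1 + p₂ + symPar 0 : ZMod 2) = p₁ + p₂ := by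
      rw [symPar_zero, add_right_comm p₁, add_assoc, show (1 + 1 : ZMod 2) = 0 from rfl, add_zero]
    have e₂ : r₁ + r₂ - symDeg 0 = r₁ + r₂ - 1 := by simp [symDeg]
    have e₃ : j₁ + 1 / 2 + j₂ - ((0 : ℤ) : ℝ) - 1 = j₁ + j₂ - 1 / 2 := by push_cast; ring
    rwa [e₁, e₂, e₃] at hm
  have hcharge : 𝓥.mode 0 𝓥.σ (𝓥.mode 0 (𝓥.superpartner β O₁) O₂) =
      ((q₁ + q₂ - β.sign : ℝ) : ℂ) • 𝓥.mode 0 (𝓥.superpartner β O₁) O₂ := by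
    have h := σ_zero_mode hΨ h₁.partner_σ_zero h₂.σ_zero 0
    rwa [sub_add_eq_add_sub] at h
  refine isBranchPrimary_of_modes hmem hcharge (fun n => ?_) (fun n => ?_) (fun n => ?_)
    (fun n => ?_)
  · rw [σ_mode_zero_mode hΨ h₁.partner_primary.2, h₂.σ_succ,
      hBPS.superpartner_mode_succ h₁ h₂]
    simp
  · rw [Γ_mode_zero_mode hΨ h₁.partner_primary.1, h₂.Γ_add_two,
      hBPS.superpartner_mode_succ h₁ h₂]
    simp
  · rcases n with _ | n
    · have h := zero_mode_of_even (mem_par (Qreg_mem β)) hΨ 0 O₂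
      have hQ := h₂.Qreg_mode 0
      rw [Nat.cast_zero] at h hQ
      rw [Nat.cast_zero, h, hQ, h₁.Qreg_zero_superpartner, zero_mode_T]
      simp
    -- The supercharge raises half the `S`-charge along the branch by `1 / 2`, which exceeds the
    -- change `1 / 2 - n` of the spin under its `n`-th mode as soon as `n ≥ 1`.
    · refine hBPS.eq_zero (β := β) (𝓥.mode_mem _ (Qreg_mem β) hmem)
        (σ_zero_mode (mem_par (Qreg_mem β)) (by simpa using hasOPE_σ_Qreg β 0) hcharge _)
        (c := 2 * (j₁ + j₂)) ?_ ?_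
      · rw [e₁, e₂]; ring
      · have : (0 : ℝ) ≤ n := Nat.cast_nonneg n
        push_cast
        linarith
  · exact mode_mode_eq_zero (mem_par (Qdesc_mem β)) hΨ h₁.Qdesc_superpartner _ 0
      (h₂.Qdesc_succ n)

/-- The superpartner of the descent bracket. It makes the bracket with `a`, the zero mode of `Ψ_a`,
satisfy the Jacobi identity. -/
lemma superpartner_superpartner_mode (ha : a ∈ 𝓥.par p) (v : V) :
    𝓥.superpartner β (𝓥.mode 0 (𝓥.superpartner β a) v) =
      sgn p • 𝓥.mode 0 (𝓥.superpartner β a) (𝓥.superpartner β v) := by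
  have h := zero_mode_of_even (mem_par (Qdesc_mem (𝓥 := 𝓥) β))
    (superpartner_mem_par (β := β) ha) 0 v
  rw [Nat.cast_zero] at h
  change 𝓥.superpartner β _ = -𝓥.mode 0 (𝓥.superpartner β (𝓥.superpartner β a)) v -
    sgn (p + 1) • 𝓥.mode 0 (𝓥.superpartner β a) (𝓥.superpartner β v) at h
  rw [h, superpartner_superpartner, sgn_add]
  simp

/-- Skew-symmetry of the descent bracket: `Q^∓_(0)` annihilates the regular operator product of `O₁`
and `O₂`, which relates `Ψ_{O₁} O₂` to `O₁ Ψ_{O₂}`. -/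
lemma superpartner_mode_skew (hBPS : 𝓥.SatisfiesBPS) (h₁ : 𝓥.IsBranchPrimary β p₁ r₁ j₁ q₁ O₁)
    (h₂ : 𝓥.IsBranchPrimary β p₂ r₂ j₂ q₂ O₂) :
    𝓥.mode 0 (𝓥.superpartner β O₁) O₂ =
      -(sgn (p₁ * p₂) • 𝓥.mode 0 (𝓥.superpartner β O₂) O₁) := by
  have h := zero_mode_of_even (mem_par (Qdesc_mem (𝓥 := 𝓥) β)) (mem_par h₁.mem) 0 O₂
  have h0 := hBPS.mode_eq_zero h₁ h₂ 0
  rw [Nat.cast_zero] at h h0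
  rw [h0, map_zero] at h
  change 0 = -𝓥.mode 0 (𝓥.superpartner β O₁) O₂ -
    sgn p₁ • 𝓥.mode 0 O₁ (𝓥.superpartner β O₂) at h
  rw [zero_mode_symm (mem_par h₂.partner_mem) (mem_par h₁.mem)
    (hBPS.superpartner_mode_succ h₂ h₁), smul_smul, add_mul, one_mul, mul_comm p₂, sgn_add,
    mul_left_comm, sgn_mul_sgn_self, mul_one] at h
  rw [← sub_eq_zero, ← neg_eq_zero, h]
  abel

/-- On branch primaries the two halves of the antisymmetrized bracket agree. -/
lemma branchBracket_eq (hBPS : 𝓥.SatisfiesBPS) (h₁ : 𝓥.IsBranchPrimary β p₁ r₁ j₁ q₁ O₁)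
    (h₂ : 𝓥.IsBranchPrimary β p₂ r₂ j₂ q₂ O₂) :
    𝓥.branchBracket β p₁ p₂ O₁ O₂ = 𝓥.mode 0 (𝓥.superpartner β O₁) O₂ := by
  rw [branchBracket, superpartner_mode_skew hBPS h₂ h₁, smul_neg, smul_smul, mul_comm p₂,
    sgn_mul_sgn_self, one_smul, sub_neg_eq_add, ← two_smul ℂ, smul_smul]
  norm_num

/-- `D_W` is a derivation of the descent bracket. -/
lemma DW_superpartner_mode (hW : 𝓥.IsSuperpotential W) (ha : a ∈ 𝓥.par p) (v : V) :
    𝓥.DW W (𝓥.mode 0 (𝓥.superpartner β a) v) =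
      𝓥.mode 0 (𝓥.superpartner β (𝓥.DW W a)) v +
        sgn p • 𝓥.mode 0 (𝓥.superpartner β a) (𝓥.DW W v) := by
  have h := zero_mode_of_even (mem_par hW.mem) (superpartner_mem_par (β := β) ha) 0 v
  rw [Nat.cast_zero, sgn_add, sgn_one] at h
  rw [superpartner_DW hW, DW, h]
  simp

lemma DW_branchBracket (hW : 𝓥.IsSuperpotential W) (ha : a ∈ 𝓥.par p₁) (hb : b ∈ 𝓥.par p₂) :
    𝓥.DW W (𝓥.branchBracket β p₁ p₂ a b) =
      𝓥.branchBracket β (p₁ + 1) p₂ (𝓥.DW W a) b +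
        sgn p₁ • 𝓥.branchBracket β p₁ (p₂ + 1) a (𝓥.DW W b) := by
  simp only [branchBracket, map_smul, map_sub, DW_superpartner_mode hW ha,
    DW_superpartner_mode hW hb, add_mul, mul_add, one_mul, mul_one, sgn_add]
  rcases zmod_two_cases p₁ with rfl | rfl <;> rcases zmod_two_cases p₂ with rfl | rfl <;>
    simp <;> module

/-- This holds since `2 D_W ^ 2 = -(W_(0) W)_(0)`, and zero modes of
total derivatives vanish. -/
lemma DW_DW (hW : 𝓥.IsSuperpotential W) (v : V) : 𝓥.DW W (𝓥.DW W v) = 0 := by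
  have h := zero_mode_of_even (mem_par hW.mem) (mem_par hW.mem) 0 v
  obtain ⟨X, hX⟩ := hW.self
  rw [Nat.cast_zero, ← hX, zero_mode_T, sgn_zero, one_smul, neg_zero, zero_sub,
    eq_neg_iff_add_eq_zero, ← two_smul ℂ] at h
  exact (smul_eq_zero.1 h).resolve_left two_ne_zero

lemma DW_nop (hW : 𝓥.IsSuperpotential W) (ha : a ∈ 𝓥.par p) (v : V) :
    𝓥.DW W (𝓥.mode (-1) a v) =
      𝓥.mode (-1) (𝓥.DW W a) v + sgn p • 𝓥.mode (-1) a (𝓥.DW W v) := by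
  simpa [DW] using mode_nop (mem_par hW.mem) ha 0 v

/-! ### The chiral ring -/

lemma IsBranchPrimary.mem_chiralRing (h : 𝓥.IsBranchPrimary β p r j q O) : O ∈ 𝓥.chiralRing β :=
  Submodule.subset_span ⟨p, r, j, q, h⟩

lemma IsBranchPrimary.mem_chiralRingPart (h : 𝓥.IsBranchPrimary β p r j q O)
    (hs : r + β.sign * q = s) : O ∈ 𝓥.chiralRingPart β p s :=
  Submodule.subset_span ⟨r, j, q, h, hs⟩

lemma chiralRingPart_le_par : 𝓥.chiralRingPart β p s ≤ 𝓥.par p :=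
  Submodule.span_le.2 fun _ ⟨_, _, _, h, _⟩ => mem_par h.mem

/-- The descent bracket `(O₁, O₂) ↦ (Ψ_{O₁})_(0) O₂` as a bilinear map. -/
def descentBracket (𝓥 : N2SuperconformalRVA V) (β : Branch) : V →ₗ[ℂ] V →ₗ[ℂ] V :=
  𝓥.mode 0 ∘ₗ 𝓥.superpartner β

lemma descentBracket_apply (a b : V) :
    𝓥.descentBracket β a b = 𝓥.mode 0 (𝓥.superpartner β a) b := rfl

lemma nop_mem_chiralRing (ha : a ∈ 𝓥.chiralRing β) (hb : b ∈ 𝓥.chiralRing β) :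
    𝓥.mode (-1) a b ∈ 𝓥.chiralRing β := by
  refine LinearMap.apply_mem_of_mem_span (𝓥.mode (-1)) ?_ ha hb
  rintro x ⟨p, r, j, q, hx⟩ y ⟨p', r', j', q', hy⟩
  exact (hx.nop hy).mem_chiralRing

lemma nop_mem_chiralRingPart (ha : a ∈ 𝓥.chiralRingPart β p₁ s₁)
    (hb : b ∈ 𝓥.chiralRingPart β p₂ s₂) :
    𝓥.mode (-1) a b ∈ 𝓥.chiralRingPart β (p₁ + p₂) (s₁ + s₂) := by
  refine LinearMap.apply_mem_of_mem_span (𝓥.mode (-1)) ?_ ha hb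
  rintro x ⟨r, j, q, hx, rfl⟩ y ⟨r', j', q', hy, rfl⟩
  exact (hx.nop hy).mem_chiralRingPart (by ring)

lemma descentBracket_mem_chiralRing (hBPS : 𝓥.SatisfiesBPS) (ha : a ∈ 𝓥.chiralRing β)
    (hb : b ∈ 𝓥.chiralRing β) : 𝓥.descentBracket β a b ∈ 𝓥.chiralRing β := by
  refine LinearMap.apply_mem_of_mem_span (𝓥.descentBracket β) ?_ ha hb
  rintro x ⟨p, r, j, q, hx⟩ y ⟨p', r', j', q', hy⟩
  exact (hx.bracket hBPS hy).mem_chiralRing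

lemma descentBracket_mem_chiralRingPart (hBPS : 𝓥.SatisfiesBPS)
    (ha : a ∈ 𝓥.chiralRingPart β p₁ s₁) (hb : b ∈ 𝓥.chiralRingPart β p₂ s₂) :
    𝓥.descentBracket β a b ∈ 𝓥.chiralRingPart β (p₁ + p₂) (s₁ + s₂ - 2) := by
  refine LinearMap.apply_mem_of_mem_span (𝓥.descentBracket β) ?_ ha hb
  rintro x ⟨r, j, q, hx, rfl⟩ y ⟨r', j', q', hy, rfl⟩
  refine (hx.bracket hBPS hy).mem_chiralRingPart ?_
  linear_combination -β.sign_mul_sign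

lemma DW_mem_chiralRing (hW : 𝓥.IsSuperpotential W) (ha : a ∈ 𝓥.chiralRing β) :
    𝓥.DW W a ∈ 𝓥.chiralRing β := by
  suffices 𝓥.chiralRing β ≤ (𝓥.chiralRing β).comap (𝓥.DW W) from this ha
  refine Submodule.span_le.2 ?_
  rintro x ⟨p, r, j, q, hx⟩
  exact (hx.DW hW).mem_chiralRing

lemma DW_mem_chiralRingPart (hW : 𝓥.IsSuperpotential W) (ha : a ∈ 𝓥.chiralRingPart β p s) :
    𝓥.DW W a ∈ 𝓥.chiralRingPart β (p + 1) (s + 1) := by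
  suffices 𝓥.chiralRingPart β p s ≤ (𝓥.chiralRingPart β (p + 1) (s + 1)).comap (𝓥.DW W) from
    this ha
  refine Submodule.span_le.2 ?_
  rintro x ⟨r, j, q, hx, rfl⟩
  exact (hx.DW hW).mem_chiralRingPart (by ring)

lemma descentBracket_skew (hBPS : 𝓥.SatisfiesBPS) (ha : a ∈ 𝓥.chiralRingPart β p₁ s₁)
    (hb : b ∈ 𝓥.chiralRingPart β p₂ s₂) :
    𝓥.descentBracket β a b = -(sgn (p₁ * p₂) • 𝓥.descentBracket β b a) := by
  rw [← sub_eq_zero, ← Submodule.mem_bot ℂ]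
  refine LinearMap.apply_mem_of_mem_span
    (𝓥.descentBracket β - -(sgn (p₁ * p₂) • (𝓥.descentBracket β).flip)) ?_ ha hb
  rintro x ⟨r, j, q, hx, -⟩ y ⟨r', j', q', hy, -⟩
  rw [Submodule.mem_bot]
  exact sub_eq_zero.2 (superpartner_mode_skew hBPS hx hy)

/-- Zero modes of superpartners are derivations of the normally-ordered product. -/
lemma descentBracket_nop (ha : a ∈ 𝓥.par p₁) (hb : b ∈ 𝓥.par p₂) (c : V) :
    𝓥.descentBracket β a (𝓥.mode (-1) b c) = 𝓥.mode (-1) (𝓥.descentBracket β a b) c +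
      sgn (p₁ * p₂) • 𝓥.mode (-1) b (𝓥.descentBracket β a c) := by
  have h := mode_nop (superpartner_mem_par (β := β) ha) hb 0 c
  rwa [add_assoc, show (1 + 1 : ZMod 2) = 0 from rfl, add_zero] at h

/-- The Jacobi identity is the commutator of the zero modes of `Ψ_a` and `Ψ_b`, since the zero mode
product of these is the superpartner of `{a, b}` up to sign. -/
lemma descentBracket_jacobi (ha : a ∈ 𝓥.par p₁) (hb : b ∈ 𝓥.par p₂) (c : V) :
    𝓥.descentBracket β a (𝓥.descentBracket β b c) =
      𝓥.descentBracket β (𝓥.descentBracket β a b) c +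
        sgn (p₁ * p₂) • 𝓥.descentBracket β b (𝓥.descentBracket β a c) := by
  have h := zero_mode_singular (superpartner_mem_par (β := β) ha)
    (superpartner_mem_par (β := β) hb) 0 c
  rw [Nat.cast_zero, add_assoc, show (1 + 1 : ZMod 2) = 0 from rfl, add_zero] at h
  simp only [descentBracket_apply, superpartner_superpartner_mode ha, map_smul,
    LinearMap.smul_apply, ← h, smul_sub, smul_smul, sgn_mul_sgn_self, one_smul, mul_add, mul_one,
    sgn_add]
  rw [mul_left_comm, sgn_mul_sgn_self, mul_one, sub_add_cancel]

lemma iSup_chiralRingPart (β : Branch) :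
    ⨆ i : ZMod 2 × ℝ, 𝓥.chiralRingPart β i.1 i.2 = 𝓥.chiralRing β := by
  refine le_antisymm (iSup_le fun i => Submodule.span_le.2 ?_) (Submodule.span_le.2 ?_)
  · rintro x ⟨r, j, q, hx, -⟩
    exact hx.mem_chiralRing
  · rintro x ⟨p, r, j, q, hx⟩
    exact Submodule.mem_iSup_of_mem (p, r + β.sign * q) (hx.mem_chiralRingPart rfl)

/-- Nonzero branch primaries have `r + 2 j` equal to the degree, so that the parts of the chiral
ring are contained in sums over disjoint sets of homogeneous components. -/
lemma chiralRingPart_le (β : Branch) (i : ZMod 2 × ℝ) :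
    𝓥.chiralRingPart β i.1 i.2 ≤
      ⨆ k ∈ {k : ZMod 2 × ℝ × ℝ | (k.1, k.2.1 + 2 * k.2.2) = i}, 𝓥.gr k.1 k.2.1 k.2.2 := by
  obtain ⟨p, s⟩ := i
  refine Submodule.span_le.2 ?_
  rintro x ⟨r, j, q, hx, rfl⟩
  rcases hx.charge_eq with rfl | hq
  · exact zero_mem _
  · refine Submodule.mem_iSup_of_mem (p, r, j) (Submodule.mem_iSup_of_mem ?_ hx.mem)
    change (p, r + 2 * j) = (p, r + β.sign * q)
    rw [hq, ← mul_assoc, β.sign_mul_sign, one_mul]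

lemma iSupIndep_chiralRingPart (β : Branch) :
    iSupIndep fun i : ZMod 2 × ℝ => 𝓥.chiralRingPart β i.1 i.2 := by
  intro i
  have h := iSupIndep.disjoint_biSup_biSup
    (f := fun k : ZMod 2 × ℝ × ℝ => 𝓥.gr k.1 k.2.1 k.2.2)
    𝓥.isInternal.submodule_iSupIndep
    (s := {k | (k.1, k.2.1 + 2 * k.2.2) = i}) (t := {k | (k.1, k.2.1 + 2 * k.2.2) ≠ i})
    (Set.disjoint_left.2 fun _ h h' => h' h)
  refine h.mono (chiralRingPart_le β i) (iSup₂_le fun k hk => ?_)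
  refine (chiralRingPart_le β k).trans (iSup₂_le fun l hl => ?_)
  have hl : (l.1, l.2.1 + 2 * l.2.2) ≠ i := fun h => hk (hl.symm.trans h)
  exact le_iSup₂_of_le l hl le_rfl

lemma chiralRing_isInternal (β : Branch) :
    DirectSum.IsInternal fun i : ZMod 2 × ℝ =>
      (𝓥.chiralRingPart β i.1 i.2).comap (𝓥.chiralRing β).subtype :=
  DirectSum.isInternal_comap_subtype (iSupIndep_chiralRingPart β) (iSup_chiralRingPart β)

lemma nop_nop (a b c : V) :
    𝓥.mode (-1) (𝓥.mode (-1) a b) c = 𝓥.mode (-1) a (𝓥.mode (-1) b c) := by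
  induction a using par_induction (𝓡 := 𝓥.toRavioloVertexAlgebra) with
  | mem p a ha =>
    induction b using par_induction (𝓡 := 𝓥.toRavioloVertexAlgebra) with
    | mem q b hb => exact nop_assoc ha hb c
    | zero => simp
    | add x y hx hy => simp only [map_add, LinearMap.add_apply, hx, hy]
  | zero => simp
  | add x y hx hy => simp only [map_add, LinearMap.add_apply, hx, hy]

/-- The chiral ring of a branch as a dg `2`-shifted Poisson algebra. -/
def chiralRingPoisson (hBPS : 𝓥.SatisfiesBPS) (hW : 𝓥.IsSuperpotential W) (β : Branch) :
    DG2ShiftedPoisson (𝓥.chiralRing β) where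
  gr p s := (𝓥.chiralRingPart β p s).comap (𝓥.chiralRing β).subtype
  isInternal := chiralRing_isInternal β
  one := ⟨𝓥.vac, isBranchPrimary_vac.mem_chiralRing⟩
  mul := (𝓥.mode (-1)).restrict₂ _ fun _ ha _ hb => nop_mem_chiralRing ha hb
  bracket := (𝓥.descentBracket β).restrict₂ _ fun _ ha _ hb =>
    descentBracket_mem_chiralRing hBPS ha hb
  d := (𝓥.DW W).restrict fun _ ha => DW_mem_chiralRing hW ha
  one_mem := isBranchPrimary_vac.mem_chiralRingPart (by simp)
  mul_mem ha hb := nop_mem_chiralRingPart ha hb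
  bracket_mem ha hb := descentBracket_mem_chiralRingPart hBPS ha hb
  d_mem ha := DW_mem_chiralRingPart hW ha
  one_mul a := Subtype.ext ((𝓥.vac_mode (-1) a).trans (if_pos rfl))
  mul_assoc a b c := Subtype.ext (nop_nop _ _ _)
  mul_comm ha hb := Subtype.ext (nop_comm (chiralRingPart_le_par ha) (chiralRingPart_le_par hb))
  bracket_skew ha hb := Subtype.ext (descentBracket_skew hBPS ha hb)
  leibniz ha hb c := Subtype.ext
    (descentBracket_nop (chiralRingPart_le_par ha) (chiralRingPart_le_par hb) _)
  jacobi ha hb c := Subtype.ext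
    (descentBracket_jacobi (chiralRingPart_le_par ha) (chiralRingPart_le_par hb) _)
  d_d a := Subtype.ext (DW_DW hW _)
  d_mul ha b := Subtype.ext (DW_nop hW (chiralRingPart_le_par ha) _)
  d_bracket ha b := Subtype.ext (DW_superpartner_mode hW (chiralRingPart_le_par ha) _)

end N2SuperconformalRVA

theorem mainTheorem9 {V : Type*} [AddCommGroup V] [Module ℂ V] (𝓥 : N2SuperconformalRVA V)
    (hBPS : 𝓥.SatisfiesBPS) (W : V) (hW : 𝓥.IsSuperpotential W) (β : Raviolo.Branch) :
    (∀ (p : ZMod 2) (r j q : ℝ) (O : V), 𝓥.IsBranchPrimary β p r j q O →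
      𝓥.IsBranchPrimary β (p + 1) (r + 1) j q (𝓥.DW W O) ∧
      𝓥.superpartner β (𝓥.DW W O) = -𝓥.DW W (𝓥.superpartner β O)) ∧
    (∀ (p₁ p₂ : ZMod 2) (r₁ j₁ q₁ r₂ j₂ q₂ : ℝ) (O₁ O₂ : V),
      𝓥.IsBranchPrimary β p₁ r₁ j₁ q₁ O₁ → 𝓥.IsBranchPrimary β p₂ r₂ j₂ q₂ O₂ →
      𝓥.DW W (𝓥.branchBracket β p₁ p₂ O₁ O₂) =
        𝓥.branchBracket β (p₁ + 1) p₂ (𝓥.DW W O₁) O₂ +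
          Raviolo.sgn p₁ • 𝓥.branchBracket β p₁ (p₂ + 1) O₁ (𝓥.DW W O₂)) ∧
    ∃ P : Raviolo.DG2ShiftedPoisson (𝓥.chiralRing β),
      (∀ p s, P.gr p s = (𝓥.chiralRingPart β p s).comap (𝓥.chiralRing β).subtype) ∧
      (P.one : V) = 𝓥.vac ∧
      (∀ a b : 𝓥.chiralRing β, (P.mul a b : V) = 𝓥.nop a b) ∧
      (∀ (p₁ p₂ : ZMod 2) (r₁ j₁ q₁ r₂ j₂ q₂ : ℝ) (a b : 𝓥.chiralRing β),
        𝓥.IsBranchPrimary β p₁ r₁ j₁ q₁ a → 𝓥.IsBranchPrimary β p₂ r₂ j₂ q₂ b →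
        (P.bracket a b : V) = 𝓥.branchBracket β p₁ p₂ a b) ∧
      (∀ a : 𝓥.chiralRing β, (P.d a : V) = 𝓥.DW W a) := by
  refine ⟨fun p r j q O h => ⟨h.DW hW, N2SuperconformalRVA.superpartner_DW hW O⟩,
    fun p₁ p₂ r₁ j₁ q₁ r₂ j₂ q₂ O₁ O₂ h₁ h₂ => N2SuperconformalRVA.DW_branchBracket hW
      (RavioloVertexAlgebra.mem_par h₁.mem) (RavioloVertexAlgebra.mem_par h₂.mem),
    N2SuperconformalRVA.chiralRingPoisson hBPS hW β, fun _ _ => rfl, rfl, fun _ _ => rfl,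
    fun p₁ p₂ r₁ j₁ q₁ r₂ j₂ q₂ a b ha hb => ?_, fun _ => rfl⟩
  exact (N2SuperconformalRVA.branchBracket_eq hBPS ha hb).symm
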